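/- Work in $H=L^2(0,1)$ (complex-valued) with norm $\|\cdot\|$, and put $\hat f(\omega)=\int_0^1 f(x)e^{-2\pi i\omega x}\,dx$ for $f\in H$, $\omega\in\mathbb R$. For an integer $M\ge 0$ let $$\mathrm T_M=\Big\{\sum_{m=-M}^{M}a_m e^{2\pi i m x}:\ a_m\in\mathbb C\Big\}\subseteq H .$$ *Sampling.* For each $N\ge1$ let $\Omega_N=\{\omega_{1,N}<\dots<\omega_{N,N}\}\subset\mathbb R$. For $0<\delta<1$, the sequence $\{\Omega_N\}$ is uniformly $\delta$-dense with bandwidths $K_N\in[0,\infty)$ if $K_N\to\infty$, $\Omega_N\subseteq[-K_N,K_N]$, and $\omega_{n+1,N}-\omega_{n,N}\le\delta$ for all $N\ge 1$ and $n=0,\dots,N$, where $\omega_{0,N}=\omega_{N,N}-2K_N$ and $\omega_{N+1,N}=\omega_{1,N}+2K_N$. Put $\mu_{n,N}=\tfrac12(\omega_{n+1,N}-\omega_{n-1,N})$, $n=1,\dots,N$. *Reconstruction.* For $f\in H$ the NUGS reconstruction $f_{N,M}$ is a minimizer over $g\in\mathrm T_M$ of $\sum_{n=1}^N\mu_{n,N}|\hat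 f(\omega_{n,N})-\hat g(\omega_{n,N})|^2$. Let $C_1(N,M)$ be the largest and $C_2(N)$ the smallest constant such that $$\sum_{n=1}^N\mu_{n,N}|\hat f(\omega_{n,N})|^2\ge C_1(N,M)\|f\|^2\ \ (f\in\mathrm T_M),\qquad \sum_{n=1}^N\mu_{n,N}|\hat f(\omega_{n,N})|^2\le C_2(N)\|f\|^2\ \ (f\in H),$$ and, when $C_1(N,M)>0$, let $C(N,M)=\sqrt{C_2(N)/C_1(N,M)}$. **Theorem.** (1) For every integer $M\ge0$, $\mathrm T_M\subseteq \mathrm H^1(0,1)$ and $$\gamma_M:=\sup\{\|f'\|: f\in\mathrm T_M,\ \|f\|=1\}\le 2\pi M .$$ (2) For every $0<\epsilon<1$ there is a constant $c>0$, depending only on $\epsilon$, such that the following holds for every $0<\delta<1-\epsilon$ and every uniformly $\delta$-dense sequence $\{\Omega_N\}$ with bandwidths $K_N$. If $N\ge1$ and $M\ge0$ are integers with $\max\{M,1\}\le c\,K_N$, then $C_1(N,M)>0$, $$C(N,M)\le\frac{1+\delta}{1-\epsilon-\delta},$$ and for every $f\in H$ the reconstruction $f_{N,M}$ exists, is unique,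 and satisfies $$\|f-f_{N,M}\|\le C(N,M)\inf_{g\in\mathrm T_M}\|f-g\|,\qquad \|f_{N,M}\|\le C(N,M)\|f\| .$$ -/

import Mathlib

open MeasureTheory Set Filter Topology
open scoped ENNReal

namespace NUGS

/-- The Hilbert space `H = L²(0,1)` of complex-valued functions. -/
abbrev H : Type := Lp ℂ 2 (volume.restrict (Ioo (0 : ℝ) 1))

/-- The Fourier transform `f̂(ω) = ∫₀¹ f(x) e^{-2πiωx} dx`, `ω ∈ ℝ`, of `f ∈ L²(0,1)`. -/
noncomputable def fourierTransform (f : H) (ω : ℝ) : ℂ :=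
  ∫ x in Ioo (0 : ℝ) 1, f x * Complex.exp (-2 * Real.pi * Complex.I * ω * x)

theorem memLp_mode (m : ℤ) :
    MemLp (fun x : ℝ => Complex.exp (2 * Real.pi * Complex.I * m * x)) 2
      (volume.restrict (Ioo (0 : ℝ) 1)) := by
  refine MemLp.of_bound (C := 1) ?_ ?_
  · exact (by fun_prop : Continuous fun x : ℝ =>
      Complex.exp (2 * Real.pi * Complex.I * m * x)).aestronglyMeasurable
  · refine ae_of_all _ fun x => ?_
    rw [Complex.norm_exp]
    simp

/-- The Fourier mode `x ↦ e^{2πimx}` as an element of `L²(0,1)`. -/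
noncomputable def mode (m : ℤ) : H := (memLp_mode m).toLp _

/-- Trigonometric polynomials of degree at most `M`: all `∑_{m=-M}^{M} a_m e^{2πimx}`, `a_m ∈ ℂ`. -/
noncomputable def trigSpace (M : ℕ) : Submodule ℂ H :=
  Submodule.span ℂ (mode '' Icc (-(M : ℤ)) M)

/-- `g ∈ L²(0,1)` is the weak derivative of `f ∈ L²(0,1)` on `(0,1)`. -/
def IsWeakDeriv (f g : H) : Prop :=
  ∀ φ : ℝ → ℝ, ContDiff ℝ (⊤ : ℕ∞) φ → HasCompactSupport φ → tsupport φ ⊆ Ioo (0 : ℝ) 1 →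
    ∫ x in Ioo (0 : ℝ) 1, f x * ((deriv φ x : ℝ) : ℂ) = - ∫ x in Ioo (0 : ℝ) 1, g x * (φ x : ℂ)

/-- Membership in the Sobolev space `H¹(0,1)`. -/
def MemH1 (f : H) : Prop := ∃ g : H, IsWeakDeriv f g

/-- `γ = sup {‖f'‖ : f ∈ T, ‖f‖ = 1}`, with `f'` the weak derivative; the supremum is taken in
`[0,∞]`. It is meant for `T ⊆ H¹(0,1)`. -/
noncomputable def gammaConst (T : Submodule ℂ H) : ℝ≥0∞ :=
  ⨆ (f : H) (g : H) (_ : f ∈ T ∧ ‖f‖ = 1 ∧ IsWeakDeriv f g), ‖g‖ₑ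

/-- The sampling points `ω_{1,N}, …, ω_{N,N}` (the values `ω N n`, `1 ≤ n ≤ N`), extended by
`ω_{0,N} = ω_{N,N} - 2 K_N` and `ω_{N+1,N} = ω_{1,N} + 2 K_N`. -/
noncomputable def extPoint (ω : ℕ → ℕ → ℝ) (K : ℕ → ℝ) (N n : ℕ) : ℝ :=
  if n = 0 then ω N N - 2 * K N
  else if n = N + 1 then ω N 1 + 2 * K N
  else ω N n

/-- The ordered point sets `Ω_N = {ω_{1,N} < … < ω_{N,N}}`, `N ≥ 1`, are uniformly `δ`-dense with
bandwidths `K_N`. Only the values `ω N n` with `1 ≤ n ≤ N` matter. -/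
structure UniformlyDense (δ : ℝ) (ω : ℕ → ℕ → ℝ) (K : ℕ → ℝ) : Prop where
  delta_pos : 0 < δ
  delta_lt_one : δ < 1
  ordered : ∀ N, 1 ≤ N → StrictMonoOn (ω N) (Icc 1 N)
  bandwidth_nonneg : ∀ N, 1 ≤ N → 0 ≤ K N
  bandwidth_tendsto : Tendsto K atTop atTop
  mem_band : ∀ N, 1 ≤ N → ∀ n ∈ Icc 1 N, ω N n ∈ Icc (-K N) (K N)
  gap_le : ∀ N, 1 ≤ N → ∀ n ≤ N, extPoint ω K N (n + 1) - extPoint ω K N n ≤ δ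

/-- The weights `μ_{n,N} = (ω_{n+1,N} - ω_{n-1,N}) / 2`, `n = 1, …, N`. -/
noncomputable def weight (ω : ℕ → ℕ → ℝ) (K : ℕ → ℝ) (N n : ℕ) : ℝ :=
  (extPoint ω K N (n + 1) - extPoint ω K N (n - 1)) / 2

/-- The weighted sampling sum `∑_{n=1}^N μ_{n,N} |f̂(ω_{n,N})|²`. -/
noncomputable def sampleSum (ω : ℕ → ℕ → ℝ) (K : ℕ → ℝ) (N : ℕ) (f : H) : ℝ :=
  ∑ n ∈ Finset.Icc 1 N, weight ω K N n * ‖fourierTransform f (ω N n)‖ ^ 2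

/-- `g` is a minimizer over `T` of the weighted least-squares functional
`h ↦ ∑_n μ_{n,N} |f̂(ω_{n,N}) - ĥ(ω_{n,N})|²`. -/
def IsReconstruction (ω : ℕ → ℕ → ℝ) (K : ℕ → ℝ) (N : ℕ) (T : Submodule ℂ H) (f g : H) : Prop :=
  IsMinOn (fun h : H => ∑ n ∈ Finset.Icc 1 N, weight ω K N n *
    ‖fourierTransform f (ω N n) - fourierTransform h (ω N n)‖ ^ 2) T g ∧ g ∈ T

/-- The largest constant `C₁` with `∑_n μ_{n,N} |f̂(ω_{n,N})|² ≥ C₁ ‖f‖²` for all `f ∈ T`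
(`T` nonzero). -/
noncomputable def lowerConst (ω : ℕ → ℕ → ℝ) (K : ℕ → ℝ) (N : ℕ) (T : Submodule ℂ H) : ℝ :=
  sSup {c : ℝ | ∀ f ∈ T, c * ‖f‖ ^ 2 ≤ sampleSum ω K N f}

/-- The smallest constant `C₂` with `∑_n μ_{n,N} |f̂(ω_{n,N})|² ≤ C₂ ‖f‖²` for all `f ∈ H`. -/
noncomputable def upperConst (ω : ℕ → ℕ → ℝ) (K : ℕ → ℝ) (N : ℕ) : ℝ :=
  sInf {c : ℝ | ∀ f : H, sampleSum ω K N f ≤ c * ‖f‖ ^ 2}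

/-- The reconstruction constant `C(N,M) = √(C₂(N) / C₁(N,M))`, meaningful when `C₁ > 0`. -/
noncomputable def reconstructionConst (ω : ℕ → ℕ → ℝ) (K : ℕ → ℝ) (N : ℕ)
    (T : Submodule ℂ H) : ℝ :=
  Real.sqrt (upperConst ω K N / lowerConst ω K N T)

end NUGS

namespace NUGS

/-! Part (1) is Parseval: on `trigSpace M` differentiation multiplies the coefficient of each mode
by a factor of modulus at most `2πM`. Since `gammaConst` ranges over all weak derivatives,
uniqueness of the weak derivative is needed as well.

For part (2), translate `(0,1)` to `(-1/2,1/2)`, which changes the transform only by a unimodular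
factor. The centered transform `F` of `f` has L² norm `‖f‖` on the line, and `‖F'‖ ≤ π‖f‖`. Cut a
band of length `2K` into cells at the midpoints of consecutive sampling points. The weights are the
cell lengths, so the sampling sum is the squared L² norm of the step function `S` equal to `F(x_n)`
on the n-th cell. Each point lies within `δ/2` of the ends of its cell, so Wirtinger's inequality
with constant `π/δ` gives `‖F - S‖ ≤ δ‖f‖` on the band (`stepError_le`). Hence `‖S‖ ≤ (1+δ)‖f‖` for
every `f` (`cellSum_le`). If the band carries at least `(1-ε)²‖f‖²` of the energy, then also `‖S‖ ≥
(1-ε-δ)‖f‖` (`le_cellSum`). Trigonometric polynomials satisfy this condition once `K` is a large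
multiple of `max(M,1)`, because their transforms decay like `1/|ω|` beyond `2M`
(`le_integral_band`).

The reconstruction is a projection onto `trigSpace M`, in general oblique, defined by least squares
for the weighted sampling operator. The two frame bounds make it unique and of norm at most
`√(C₂/C₁)`. The error bound with the same constant reflects that a projection and its complement
have equal norms (`IsLeastSquares.norm_sub_le`). -/

/-! ### Fourier transform on L²(0,1): linearity and Parseval. -/

theorem integrable_coe (f : H) : Integrable f (volume.restrict (Ioo (0 : ℝ) 1)) :=
  (Lp.memLp f).integrable (by norm_num)

theorem norm_sq_eq_integral (f : H) : ‖f‖ ^ 2 = ∫ x in Ioo (0 : ℝ) 1, ‖f x‖ ^ 2 := by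
  have h := congr_arg RCLike.re (L2.inner_def (𝕜 := ℂ) f f)
  rw [← integral_re (L2.integrable_inner f f)] at h
  simpa only [← norm_sq_eq_re_inner] using h

theorem norm_exp_phase (ω x : ℝ) : ‖Complex.exp (-2 * Real.pi * Complex.I * ω * x)‖ = 1 := by
  rw [Complex.norm_exp]
  simp

theorem integrable_mul_phase (f : H) (ω : ℝ) :
    Integrable (fun x : ℝ => f x * Complex.exp (-2 * Real.pi * Complex.I * ω * x))
      (volume.restrict (Ioo (0 : ℝ) 1)) := by
  refine (integrable_coe f).mul_bdd (c := 1) ?_ (ae_of_all _ fun x => (norm_exp_phase ω x).le)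
  exact (by fun_prop : Continuous fun x : ℝ =>
    Complex.exp (-2 * Real.pi * Complex.I * ω * x)).aestronglyMeasurable

theorem fourierTransform_add (f g : H) (ω : ℝ) :
    fourierTransform (f + g) ω = fourierTransform f ω + fourierTransform g ω := by
  unfold fourierTransform
  rw [← integral_add (integrable_mul_phase f ω) (integrable_mul_phase g ω)]
  refine integral_congr_ae ?_
  filter_upwards [Lp.coeFn_add f g] with x hx
  rw [hx, Pi.add_apply, add_mul]

theorem fourierTransform_smul (a : ℂ) (f : H) (ω : ℝ) :
    fourierTransform (a • f) ω = a * fourierTransform f ω := by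
  unfold fourierTransform
  rw [← integral_const_mul]
  refine integral_congr_ae ?_
  filter_upwards [Lp.coeFn_smul a f] with x hx
  rw [hx, Pi.smul_apply, smul_eq_mul, mul_assoc]

/-- Evaluation of the Fourier transform at `ω`, as a linear functional on `L²(0,1)`. -/
noncomputable def fourierEval (ω : ℝ) : H →ₗ[ℂ] ℂ where
  toFun f := fourierTransform f ω
  map_add' f g := fourierTransform_add f g ω
  map_smul' a f := fourierTransform_smul a f ω

@[simp]
theorem fourierEval_apply (ω : ℝ) (f : H) : fourierEval ω f = fourierTransform f ω := rfl

/-- Parseval's identity for the modulated function `x ↦ f x * e^{-2πitx}`. -/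
theorem hasSum_sq_fourierTransform (f : H) (t : ℝ) :
    HasSum (fun k : ℤ => ‖fourierTransform f (t + k)‖ ^ 2) (‖f‖ ^ 2) := by
  have hmem : MemLp (fun x : ℝ => f x * Complex.exp (-2 * Real.pi * Complex.I * t * x)) 2
      (volume.restrict (Ioc (0 : ℝ) 1)) := by
    rw [← restrict_Ioo_eq_restrict_Ioc]
    refine (memLp_congr_norm ?_ (Lp.memLp f).1 (ae_of_all _ fun x => ?_)).2 (Lp.memLp f)
    · exact (Lp.memLp f).1.mul (by fun_prop : Continuous fun x : ℝ =>
        Complex.exp (-2 * Real.pi * Complex.I * t * x)).aestronglyMeasurable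
    · rw [norm_mul, norm_exp_phase, mul_one]
  convert hasSum_sq_fourierCoeffOn (zero_lt_one' ℝ) hmem using 1
  · ext k
    congr 2
    rw [fourierCoeffOn_eq_integral, intervalIntegral.integral_of_le zero_le_one,
      ← restrict_Ioo_eq_restrict_Ioc]
    simp only [sub_zero, div_one, one_smul, fourierTransform]
    refine integral_congr_ae (ae_of_all _ fun x => ?_)
    simp only [smul_eq_mul, fourier_coe_apply]
    rw [mul_left_comm, ← Complex.exp_add]
    congr 2
    push_cast
    ring
  · rw [intervalIntegral.integral_of_le zero_le_one, ← restrict_Ioo_eq_restrict_Ioc,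
      norm_sq_eq_integral]
    simp only [norm_mul, norm_exp_phase, mul_one, sub_zero, inv_one, one_smul]

/-! ### Centered transform: Bernstein and Plancherel. -/

/-- The Fourier transform of `f`, with `(0,1)` translated to `(-1/2,1/2)`. -/
noncomputable def centeredTransform (f : H) (ω : ℝ) : ℂ :=
  Complex.exp (Real.pi * Complex.I * ω) * fourierTransform f ω

theorem norm_centeredTransform (f : H) (ω : ℝ) :
    ‖centeredTransform f ω‖ = ‖fourierTransform f ω‖ := by
  rw [centeredTransform, norm_mul, Complex.norm_exp]
  simp

theorem centeredTransform_eq_integral (f : H) (ω : ℝ) :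
    centeredTransform f ω = ∫ x in Ioo (0 : ℝ) 1,
      f x * Complex.exp (Real.pi * Complex.I * (1 - 2 * x) * ω) := by
  rw [centeredTransform, fourierTransform, ← integral_const_mul]
  refine integral_congr_ae (ae_of_all _ fun x => ?_)
  simp only
  rw [mul_left_comm, ← Complex.exp_add]
  congr 2
  ring

theorem norm_exp_centered (ω x : ℝ) :
    ‖Complex.exp (Real.pi * Complex.I * (1 - 2 * x) * ω)‖ = 1 := by
  rw [Complex.norm_exp]
  simp

/-- This is where centering pays: the frequency factor is at most `π`, whereas on `(0,1)` it would
reach `2π` and the gap condition `δ < 1` would not suffice. -/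
theorem norm_derivFactor_le {x : ℝ} (hx : x ∈ Ioo (0 : ℝ) 1) :
    ‖(Real.pi * Complex.I * (1 - 2 * x) : ℂ)‖ ≤ Real.pi := by
  have h : ((1 : ℂ) - 2 * x) = ((1 - 2 * x : ℝ) : ℂ) := by push_cast; ring
  rw [h, norm_mul, norm_mul, Complex.norm_I, Complex.norm_real, Complex.norm_real,
    Real.norm_of_nonneg Real.pi_pos.le, mul_one]
  have : ‖(1 - 2 * x : ℝ)‖ ≤ 1 := by
    rw [Real.norm_eq_abs, abs_le]
    constructor <;> linarith [hx.1, hx.2]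
  nlinarith [Real.pi_pos]

/-- Bernstein's inequality for the centered transform, in transformed form: the derivative is the
centered transform of a function of norm at most `π ‖f‖`. -/
theorem exists_hasDerivAt_centeredTransform (f : H) :
    ∃ g : H, ‖g‖ ≤ Real.pi * ‖f‖ ∧
      ∀ ω, HasDerivAt (centeredTransform f) (centeredTransform g ω) ω := by
  have hle : ∀ᵐ x ∂(volume.restrict (Ioo (0 : ℝ) 1)),
      ‖f x * (Real.pi * Complex.I * (1 - 2 * x) : ℂ)‖ ≤ Real.pi * ‖f x‖ := by
    filter_upwards [ae_restrict_mem measurableSet_Ioo] with x hx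
    rw [norm_mul, mul_comm]
    exact mul_le_mul_of_nonneg_right (norm_derivFactor_le hx) (norm_nonneg _)
  have hmeas : AEStronglyMeasurable (fun x : ℝ => f x * (Real.pi * Complex.I * (1 - 2 * x) : ℂ))
      (volume.restrict (Ioo (0 : ℝ) 1)) :=
    (Lp.memLp f).1.mul (by fun_prop : Continuous fun x : ℝ =>
      (Real.pi * Complex.I * (1 - 2 * x) : ℂ)).aestronglyMeasurable
  have hmem : MemLp (fun x : ℝ => f x * (Real.pi * Complex.I * (1 - 2 * x) : ℂ)) 2
      (volume.restrict (Ioo (0 : ℝ) 1)) := (Lp.memLp f).of_le_mul hmeas hle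
  refine ⟨hmem.toLp _, ?_, fun ω => ?_⟩
  · refine Lp.norm_le_mul_norm_of_ae_le_mul ?_
    filter_upwards [hmem.coeFn_toLp, hle] with x hx h
    rwa [hx]
  · have key := hasDerivAt_integral_of_dominated_loc_of_deriv_le
      (μ := volume.restrict (Ioo (0 : ℝ) 1)) (x₀ := ω) (s := univ)
      (F := fun (ω x : ℝ) => f x * Complex.exp (Real.pi * Complex.I * (1 - 2 * x) * ω))
      (F' := fun (ω x : ℝ) => f x * (Real.pi * Complex.I * (1 - 2 * x)) *
        Complex.exp (Real.pi * Complex.I * (1 - 2 * x) * ω))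
      (bound := fun x => Real.pi * ‖f x‖) univ_mem ?_ ?_ ?_ ?_ ?_ ?_
    · have h1 : centeredTransform f = fun ω : ℝ => ∫ x in Ioo (0 : ℝ) 1,
          f x * Complex.exp (Real.pi * Complex.I * (1 - 2 * x) * ω) :=
        funext (centeredTransform_eq_integral f)
      rw [h1]
      refine key.2.congr_deriv (Eq.symm ?_)
      rw [centeredTransform_eq_integral]
      refine integral_congr_ae ?_
      filter_upwards [hmem.coeFn_toLp] with x hx
      rw [hx]
    · refine Eventually.of_forall fun ω => (Lp.memLp f).1.mul ?_
      exact (by fun_prop : Continuous fun x : ℝ =>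
        Complex.exp (Real.pi * Complex.I * (1 - 2 * x) * ω)).aestronglyMeasurable
    · refine (integrable_coe f).mul_bdd (c := 1) ?_ (ae_of_all _ fun x => (norm_exp_centered ω x).le)
      exact (by fun_prop : Continuous fun x : ℝ =>
        Complex.exp (Real.pi * Complex.I * (1 - 2 * x) * ω)).aestronglyMeasurable
    · refine hmeas.mul ?_
      exact (by fun_prop : Continuous fun x : ℝ =>
        Complex.exp (Real.pi * Complex.I * (1 - 2 * x) * ω)).aestronglyMeasurable
    · filter_upwards [hle] with x hx y _
      rwa [norm_mul, norm_exp_centered, mul_one]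
    · exact (integrable_coe f).norm.const_mul _
    · refine ae_of_all _ fun x y _ => ?_
      have h := (((hasDerivAt_id (y : ℂ)).const_mul
        (Real.pi * Complex.I * (1 - 2 * x) : ℂ)).cexp.const_mul (f x)).comp_ofReal
      refine h.congr_deriv ?_
      rw [id]
      ring

theorem continuous_centeredTransform (f : H) : Continuous (centeredTransform f) := by
  obtain ⟨g, -, hg⟩ := exists_hasDerivAt_centeredTransform f
  exact continuous_iff_continuousAt.2 fun ω => (hg ω).continuousAt

/-- Periodization: the line is the union of the integer translates of `(0,1]`, and by Parseval the
sum over translates is the constant `‖f‖²` at every `t`. -/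
theorem lintegral_sq_centeredTransform (f : H) :
    ∫⁻ ω : ℝ, ENNReal.ofReal (‖centeredTransform f ω‖ ^ 2) = ENNReal.ofReal (‖f‖ ^ 2) := by
  set G : ℝ → ℝ≥0∞ := fun ω => ENNReal.ofReal (‖centeredTransform f ω‖ ^ 2) with hG
  have hGm : Measurable G :=
    (((continuous_centeredTransform f).norm.pow 2).measurable).ennreal_ofReal
  have hcover : ∫⁻ ω : ℝ, G ω = ∑' k : ℤ, ∫⁻ ω in Ioc ((0 : ℝ) + k) (0 + k + 1), G ω := by
    rw [← lintegral_iUnion (fun k => measurableSet_Ioc) (pairwise_disjoint_Ioc_add_intCast (0 : ℝ)),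
      iUnion_Ioc_add_intCast, Measure.restrict_univ]
  have hshift : ∀ k : ℤ, ∫⁻ ω in Ioc ((0 : ℝ) + k) (0 + k + 1), G ω =
      ∫⁻ t in Ioc (0 : ℝ) 1, G (t + k) := fun k => by
    have h := (measurePreserving_add_right volume (k : ℝ)).setLIntegral_comp_preimage
      (s := Ioc ((0 : ℝ) + k) (0 + k + 1)) measurableSet_Ioc hGm
    rw [← h]
    congr 2
    ext x
    simp only [mem_preimage, mem_Ioc]
    constructor <;> rintro ⟨h1, h2⟩ <;> constructor <;> linarith
  rw [hcover]
  simp_rw [hshift]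
  rw [← lintegral_tsum (f := fun (k : ℤ) (t : ℝ) => G (t + k))
    fun k => (hGm.comp (measurable_add_const _)).aemeasurable]
  have hpt : ∀ t : ℝ, ∑' k : ℤ, G (t + k) = ENNReal.ofReal (‖f‖ ^ 2) := fun t => by
    have h := hasSum_sq_fourierTransform f t
    rw [← h.tsum_eq, ENNReal.ofReal_tsum_of_nonneg (fun _ => by positivity) h.summable]
    simp only [hG, norm_centeredTransform]
  simp_rw [hpt]
  simp

theorem integrable_sq_centeredTransform (f : H) :
    Integrable fun ω : ℝ => ‖centeredTransform f ω‖ ^ 2 := by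
  refine ⟨((continuous_centeredTransform f).norm.pow 2).aestronglyMeasurable, ?_⟩
  rw [hasFiniteIntegral_iff_ofReal (ae_of_all _ fun _ => by positivity),
    lintegral_sq_centeredTransform]
  exact ENNReal.ofReal_lt_top

/-- Plancherel's identity. -/
theorem integral_sq_centeredTransform (f : H) :
    ∫ ω : ℝ, ‖centeredTransform f ω‖ ^ 2 = ‖f‖ ^ 2 := by
  rw [integral_eq_lintegral_of_nonneg_ae (ae_of_all _ fun _ => by positivity)
    (integrable_sq_centeredTransform f).aestronglyMeasurable,
    lintegral_sq_centeredTransform, ENNReal.toReal_ofReal (by positivity)]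

theorem intervalIntegral_sq_centeredTransform_le (f : H) {a b : ℝ} (hab : a ≤ b) :
    ∫ ω in a..b, ‖centeredTransform f ω‖ ^ 2 ≤ ‖f‖ ^ 2 := by
  rw [← integral_sq_centeredTransform f, intervalIntegral.integral_of_le hab]
  exact setIntegral_le_integral (integrable_sq_centeredTransform f)
    (ae_of_all _ fun _ => by positivity)

/-! ### Wirtinger inequalities. -/

/-- Wirtinger's inequality for a function vanishing at the left endpoint. -/
theorem wirtinger_left {u u' : ℝ → ℂ} {p e k : ℝ} (hpe : p ≤ e) (hk : 0 < k)
    (hke : k * (e - p) < Real.pi / 2) (hu : ∀ x, HasDerivAt u (u' x) x) (hu' : Continuous u')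
    (hp : u p = 0) :
    k ^ 2 * ∫ x in p..e, ‖u x‖ ^ 2 ≤ ∫ x in p..e, ‖u' x‖ ^ 2 := by
  have hcu : Continuous u := continuous_iff_continuousAt.2 fun x => (hu x).continuousAt
  have hcos : ∀ x ∈ Icc p e, Real.cos (k * (e - x)) ≠ 0 := fun x hx => by
    refine (Real.cos_pos_of_mem_Ioo ⟨?_, ?_⟩).ne'
    · have := mul_nonneg hk.le (sub_nonneg.2 hx.2)
      linarith [Real.pi_pos]
    · have : k * (e - x) ≤ k * (e - p) := by gcongr; exact hx.1
      linarith
  -- `q` solves the Riccati equation `q' = -k² - q²` with `q(e) = 0`. Expanding `‖u' - q u‖² ≥ 0`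
  -- gives `‖u'‖² ≥ k²‖u‖² + (q‖u‖²)'`, and the total derivative integrates to zero because `u(p) =
  -- 0` and `q(e) = 0`.
  set q : ℝ → ℝ := fun x => k * Real.tan (k * (e - x)) with hq
  have hqd : ∀ x ∈ Icc p e, HasDerivAt q (-(k ^ 2) - q x ^ 2) x := fun x hx => by
    have h1 : HasDerivAt (fun x : ℝ => k * (e - x)) (k * (-1)) x :=
      ((hasDerivAt_id x).const_sub e).const_mul k
    have h2 := ((Real.hasDerivAt_tan (hcos x hx)).comp x h1).const_mul k
    refine h2.congr_deriv ?_
    simp only [hq]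
    rw [Real.tan_eq_sin_div_cos]
    have := hcos x hx
    field_simp
    linarith [Real.sin_sq_add_cos_sq (k * (e - x)),
      mul_comm (k ^ 2) (Real.sin (k * (e - x)) ^ 2 + Real.cos (k * (e - x)) ^ 2 - 1)]
  set D : ℝ → ℝ := fun x => (-(k ^ 2) - q x ^ 2) * ‖u x‖ ^ 2 +
    q x * (2 * inner ℝ (u x) (u' x)) with hD
  have hWd : ∀ x ∈ uIcc p e, HasDerivAt (fun x => q x * ‖u x‖ ^ 2) (D x) x := fun x hx => by
    rw [uIcc_of_le hpe] at hx
    exact (hqd x hx).mul (hu x).norm_sq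
  have hqc : ContinuousOn q (uIcc p e) := fun x hx => by
    rw [uIcc_of_le hpe] at hx
    exact (hqd x hx).continuousAt.continuousWithinAt
  have hDc : ContinuousOn D (uIcc p e) := by
    have h1 : Continuous fun x => ‖u x‖ ^ 2 := by fun_prop
    have h2 : Continuous fun x => 2 * inner ℝ (u x) (u' x) := by fun_prop
    exact ((continuousOn_const.sub (hqc.pow 2)).mul h1.continuousOn).add
      (hqc.mul h2.continuousOn)
  have hftc : ∫ x in p..e, D x = 0 := by
    rw [intervalIntegral.integral_eq_sub_of_hasDerivAt hWd hDc.intervalIntegrable]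
    simp [hq, hp]
  have hI1 : IntervalIntegrable (fun x => k ^ 2 * ‖u x‖ ^ 2) volume p e :=
    (by fun_prop : Continuous fun x => k ^ 2 * ‖u x‖ ^ 2).intervalIntegrable _ _
  have hI2 : IntervalIntegrable (fun x => ‖u' x‖ ^ 2) volume p e :=
    (by fun_prop : Continuous fun x => ‖u' x‖ ^ 2).intervalIntegrable _ _
  have hmono : ∫ x in p..e, (k ^ 2 * ‖u x‖ ^ 2 + D x) ≤ ∫ x in p..e, ‖u' x‖ ^ 2 := by
    refine intervalIntegral.integral_mono_on hpe (hI1.add hDc.intervalIntegrable) hI2 fun x _ => ?_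
    have h := norm_sub_sq_real (u' x) (q x • u x)
    rw [inner_smul_right, norm_smul, mul_pow, Real.norm_eq_abs, sq_abs, real_inner_comm] at h
    have h0 : 0 ≤ ‖u' x - q x • u x‖ ^ 2 := by positivity
    simp only [hD]
    nlinarith
  rwa [intervalIntegral.integral_add hI1 hDc.intervalIntegrable, hftc, add_zero,
    intervalIntegral.integral_const_mul] at hmono

/-- Wirtinger's inequality for a function vanishing at the right endpoint. -/
theorem wirtinger_right {u u' : ℝ → ℂ} {p e k : ℝ} (hpe : e ≤ p) (hk : 0 < k)
    (hke : k * (p - e) < Real.pi / 2) (hu : ∀ x, HasDerivAt u (u' x) x) (hu' : Continuous u')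
    (hp : u p = 0) :
    k ^ 2 * ∫ x in e..p, ‖u x‖ ^ 2 ≤ ∫ x in e..p, ‖u' x‖ ^ 2 := by
  have h := wirtinger_left (u := fun x => u (-x)) (u' := fun x => -u' (-x)) (neg_le_neg hpe) hk
    (by rwa [show -e - -p = p - e by ring])
    (fun x => by
      have h := (hu (-x)).scomp x (hasDerivAt_neg x)
      rw [neg_smul, one_smul] at h
      exact h) (by fun_prop) (by simpa using hp)
  simp only [norm_neg] at h
  rwa [intervalIntegral.integral_comp_neg (fun x => ‖u x‖ ^ 2),
    intervalIntegral.integral_comp_neg (fun x => ‖u' x‖ ^ 2), neg_neg, neg_neg] at h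

/-- Wirtinger's inequality for a function vanishing at an interior point. -/
theorem wirtinger_interior {u u' : ℝ → ℂ} {a p b k : ℝ} (hap : a ≤ p) (hpb : p ≤ b) (hk : 0 < k)
    (hka : k * (p - a) < Real.pi / 2) (hkb : k * (b - p) < Real.pi / 2)
    (hu : ∀ x, HasDerivAt u (u' x) x) (hu' : Continuous u') (hp : u p = 0) :
    k ^ 2 * ∫ x in a..b, ‖u x‖ ^ 2 ≤ ∫ x in a..b, ‖u' x‖ ^ 2 := by
  have hcu : Continuous u := continuous_iff_continuousAt.2 fun x => (hu x).continuousAt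
  have hI1 : ∀ a b, IntervalIntegrable (fun x => ‖u x‖ ^ 2) volume a b :=
    (by fun_prop : Continuous fun x => ‖u x‖ ^ 2).intervalIntegrable
  have hI2 : ∀ a b, IntervalIntegrable (fun x => ‖u' x‖ ^ 2) volume a b :=
    (by fun_prop : Continuous fun x => ‖u' x‖ ^ 2).intervalIntegrable
  rw [← intervalIntegral.integral_add_adjacent_intervals (hI1 a p) (hI1 p b),
    ← intervalIntegral.integral_add_adjacent_intervals (hI2 a p) (hI2 p b), mul_add]
  exact add_le_add (wirtinger_right hap hk hka hu hu' hp) (wirtinger_left hpb hk hkb hu hu' hp)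

/-! ### Step-function approximation and frame bounds for nonuniform samples. -/

section Cells

variable {x : ℕ → ℝ} {N : ℕ}

/-- Midpoints of consecutive points. -/
noncomputable def midpt (x : ℕ → ℝ) (n : ℕ) : ℝ := (x n + x (n + 1)) / 2

/-- The squared `L²` distance between the centered transform and its sampled step function. -/
noncomputable def stepError (x : ℕ → ℝ) (N : ℕ) (f : H) : ℝ :=
  ∑ n ∈ Finset.range N, ∫ ω in midpt x n..midpt x (n + 1),
    ‖centeredTransform f ω - centeredTransform f (x (n + 1))‖ ^ 2

theorem sum_integral_cells (x : ℕ → ℝ) (N : ℕ) {φ : ℝ → ℝ} (hφ : Continuous φ) :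
    ∑ n ∈ Finset.range N, ∫ ω in midpt x n..midpt x (n + 1), φ ω =
      ∫ ω in midpt x 0..midpt x N, φ ω :=
  intervalIntegral.sum_integral_adjacent_intervals fun _ _ => hφ.intervalIntegrable _ _

theorem midpt_le_left (hmono : ∀ n ≤ N, x n ≤ x (n + 1)) {n : ℕ} (hn : n ≤ N) :
    midpt x n ≤ x (n + 1) := by
  have := hmono n hn
  unfold midpt
  linarith

theorem le_midpt (hmono : ∀ n ≤ N, x n ≤ x (n + 1)) {n : ℕ} (hn : n ≤ N) :
    x n ≤ midpt x n := by
  have := hmono n hn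
  unfold midpt
  linarith

theorem midpt_le_succ (hmono : ∀ n ≤ N, x n ≤ x (n + 1)) {n : ℕ} (hn : n < N) :
    midpt x n ≤ midpt x (n + 1) :=
  (midpt_le_left hmono hn.le).trans (le_midpt hmono hn)

theorem midpt_zero_le (hmono : ∀ n ≤ N, x n ≤ x (n + 1)) : midpt x 0 ≤ midpt x N := by
  have h : ∀ n ≤ N, midpt x 0 ≤ midpt x n := fun n => by
    induction n with
    | zero => exact fun _ => le_rfl
    | succ n ih => exact fun hn => (ih (by omega)).trans (midpt_le_succ hmono hn)
  exact h N le_rfl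

/-- On each cell `F - F(x_{n+1})` vanishes at `x_{n+1}`, which is within `δ/2` of both ends.
Wirtinger costs a factor `δ/π` in norm and Bernstein returns `π`, leaving exactly `δ`. -/
theorem stepError_le {δ : ℝ} (hδ : 0 < δ) (hmono : ∀ n ≤ N, x n ≤ x (n + 1))
    (hgap : ∀ n ≤ N, x (n + 1) - x n ≤ δ) (f : H) :
    stepError x N f ≤ δ ^ 2 * ‖f‖ ^ 2 := by
  obtain ⟨g, hgn, hg⟩ := exists_hasDerivAt_centeredTransform f
  have hcg := continuous_centeredTransform g
  have hk : ∀ k, 0 < k → k < Real.pi / δ → k ^ 2 * stepError x N f ≤ (Real.pi * ‖f‖) ^ 2 := by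
    intro k hk hkδ
    rw [lt_div_iff₀ hδ] at hkδ
    have hcell : ∀ n ∈ Finset.range N,
        k ^ 2 * ∫ ω in midpt x n..midpt x (n + 1),
          ‖centeredTransform f ω - centeredTransform f (x (n + 1))‖ ^ 2 ≤
        ∫ ω in midpt x n..midpt x (n + 1), ‖centeredTransform g ω‖ ^ 2 := fun n hn => by
      have hn' := Finset.mem_range.1 hn
      have h1 := hgap n hn'.le
      have h2 := hgap (n + 1) hn'
      refine wirtinger_interior (p := x (n + 1)) (midpt_le_left hmono hn'.le)
        (le_midpt hmono hn') hk ?_ ?_ (fun ω => (hg ω).sub_const _) hcg (sub_self _)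
      · have : x (n + 1) - midpt x n ≤ δ / 2 := by unfold midpt; linarith
        have := mul_le_mul_of_nonneg_left this hk.le
        linarith
      · have : midpt x (n + 1) - x (n + 1) ≤ δ / 2 := by unfold midpt; linarith
        have := mul_le_mul_of_nonneg_left this hk.le
        linarith
    calc k ^ 2 * stepError x N f
        ≤ ∑ n ∈ Finset.range N, ∫ ω in midpt x n..midpt x (n + 1), ‖centeredTransform g ω‖ ^ 2 := by
          rw [stepError, Finset.mul_sum]
          exact Finset.sum_le_sum hcell
      _ = ∫ ω in midpt x 0..midpt x N, ‖centeredTransform g ω‖ ^ 2 :=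
          sum_integral_cells x N (by fun_prop)
      _ ≤ ‖g‖ ^ 2 := intervalIntegral_sq_centeredTransform_le g (midpt_zero_le hmono)
      _ ≤ (Real.pi * ‖f‖) ^ 2 := by gcongr
  have hpos : 0 < Real.pi / δ := by positivity
  -- Wirtinger was proved for `k` strictly below the critical value, where the tangent stays finite;
  -- the sharp constant follows by continuity in `k`.
  have hlim : (Real.pi / δ) ^ 2 * stepError x N f ≤ (Real.pi * ‖f‖) ^ 2 := by
    have ht : Tendsto (fun k : ℝ => k ^ 2 * stepError x N f) (𝓝[<] (Real.pi / δ))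
        (𝓝 ((Real.pi / δ) ^ 2 * stepError x N f)) :=
      ((by fun_prop : Continuous fun k : ℝ => k ^ 2 * stepError x N f).tendsto _).mono_left
        nhdsWithin_le_nhds
    refine le_of_tendsto ht ?_
    filter_upwards [Ioo_mem_nhdsLT hpos] with k hk' using hk k hk'.1 hk'.2
  have hpi := Real.pi_pos
  rw [div_pow, div_mul_eq_mul_div, div_le_iff₀ (by positivity)] at hlim
  have : Real.pi ^ 2 * stepError x N f ≤ Real.pi ^ 2 * (δ ^ 2 * ‖f‖ ^ 2) := by linarith
  exact le_of_mul_le_mul_left this (by positivity)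

/-- A squared triangle inequality with a free parameter: integrated cell by cell and then optimized
over `t`, it replaces Minkowski's inequality in L². -/
theorem sq_le_add_mul_sq {E : Type*} [SeminormedAddCommGroup E] (a b : E) {t : ℝ} (ht : 0 < t) :
    ‖a‖ ^ 2 ≤ (1 + t) * ‖b‖ ^ 2 + (1 + t⁻¹) * ‖b - a‖ ^ 2 := by
  have h1 : ‖a‖ ≤ ‖b‖ + ‖b - a‖ := by
    rw [norm_sub_rev]
    exact norm_le_insert' a b
  have h2 : ‖a‖ ^ 2 ≤ (‖b‖ + ‖b - a‖) ^ 2 := by gcongr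
  have h3 : (1 + t) * ‖b‖ ^ 2 + (1 + t⁻¹) * ‖b - a‖ ^ 2 - (‖b‖ + ‖b - a‖) ^ 2 =
      t⁻¹ * (t * ‖b‖ - ‖b - a‖) ^ 2 := by
    field_simp
    ring
  have h4 : 0 ≤ t⁻¹ * (t * ‖b‖ - ‖b - a‖) ^ 2 := by positivity
  linarith

/-- The sampling sum of the centered transform. -/
noncomputable def cellSum (x : ℕ → ℝ) (N : ℕ) (f : H) : ℝ :=
  ∑ n ∈ Finset.range N, (midpt x (n + 1) - midpt x n) * ‖fourierTransform f (x (n + 1))‖ ^ 2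

theorem cellSum_eq_sum_integral (x : ℕ → ℝ) (N : ℕ) (f : H) :
    cellSum x N f = ∑ n ∈ Finset.range N, ∫ _ω in midpt x n..midpt x (n + 1),
      ‖centeredTransform f (x (n + 1))‖ ^ 2 := by
  simp [cellSum, norm_centeredTransform]

theorem cellSum_le_add (hmono : ∀ n ≤ N, x n ≤ x (n + 1)) (f : H) {t : ℝ} (ht : 0 < t) :
    cellSum x N f ≤ (1 + t) * (∫ ω in midpt x 0..midpt x N, ‖centeredTransform f ω‖ ^ 2) +
      (1 + t⁻¹) * stepError x N f := by
  have hc := continuous_centeredTransform f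
  rw [cellSum_eq_sum_integral, ← sum_integral_cells x N (by fun_prop), stepError, Finset.mul_sum,
    Finset.mul_sum, ← Finset.sum_add_distrib]
  refine Finset.sum_le_sum fun n hn => ?_
  rw [← intervalIntegral.integral_const_mul, ← intervalIntegral.integral_const_mul,
    ← intervalIntegral.integral_add ((by fun_prop : Continuous _).intervalIntegrable _ _)
      ((by fun_prop : Continuous _).intervalIntegrable _ _)]
  exact intervalIntegral.integral_mono_on (midpt_le_succ hmono (Finset.mem_range.1 hn))
    ((by fun_prop : Continuous _).intervalIntegrable _ _)
    ((by fun_prop : Continuous _).intervalIntegrable _ _) fun ω _ => sq_le_add_mul_sq _ _ ht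

theorem integral_le_cellSum_add (hmono : ∀ n ≤ N, x n ≤ x (n + 1)) (f : H) {t : ℝ} (ht : 0 < t) :
    ∫ ω in midpt x 0..midpt x N, ‖centeredTransform f ω‖ ^ 2 ≤
      (1 + t) * cellSum x N f + (1 + t⁻¹) * stepError x N f := by
  have hc := continuous_centeredTransform f
  rw [cellSum_eq_sum_integral, ← sum_integral_cells x N (by fun_prop), stepError, Finset.mul_sum,
    Finset.mul_sum, ← Finset.sum_add_distrib]
  refine Finset.sum_le_sum fun n hn => ?_
  rw [← intervalIntegral.integral_const_mul, ← intervalIntegral.integral_const_mul,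
    ← intervalIntegral.integral_add ((by fun_prop : Continuous _).intervalIntegrable _ _)
      ((by fun_prop : Continuous _).intervalIntegrable _ _)]
  refine intervalIntegral.integral_mono_on (midpt_le_succ hmono (Finset.mem_range.1 hn))
    ((by fun_prop : Continuous _).intervalIntegrable _ _)
    ((by fun_prop : Continuous _).intervalIntegrable _ _) fun ω _ => ?_
  rw [norm_sub_rev]
  exact sq_le_add_mul_sq _ _ ht

/-- Upper frame bound for nonuniform samples with gaps at most `δ`. -/
theorem cellSum_le {δ : ℝ} (hδ : 0 < δ) (hmono : ∀ n ≤ N, x n ≤ x (n + 1))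
    (hgap : ∀ n ≤ N, x (n + 1) - x n ≤ δ) (f : H) :
    cellSum x N f ≤ (1 + δ) ^ 2 * ‖f‖ ^ 2 := by
  -- `t = δ` is the ratio of the two norm bounds `δ‖f‖` and `‖f‖`, so the sum becomes the perfect
  -- square `(1 + δ)²`.
  have h1 := cellSum_le_add hmono f hδ
  have h2 := intervalIntegral_sq_centeredTransform_le f (midpt_zero_le hmono)
  have h3 := stepError_le hδ hmono hgap f
  calc cellSum x N f ≤ (1 + δ) * ‖f‖ ^ 2 + (1 + δ⁻¹) * (δ ^ 2 * ‖f‖ ^ 2) := by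
        refine h1.trans ?_
        gcongr
    _ = (1 + δ) ^ 2 * ‖f‖ ^ 2 := by
        field_simp
        ring

/-- Lower frame bound for nonuniform samples with gaps at most `δ`, for functions whose transform
is concentrated on the sampled band. -/
theorem le_cellSum {δ ε : ℝ} (hδ : 0 < δ) (hε : ε < 1 - δ)
    (hmono : ∀ n ≤ N, x n ≤ x (n + 1)) (hgap : ∀ n ≤ N, x (n + 1) - x n ≤ δ) (f : H)
    (hf : (1 - ε) ^ 2 * ‖f‖ ^ 2 ≤ ∫ ω in midpt x 0..midpt x N, ‖centeredTransform f ω‖ ^ 2) :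
    (1 - ε - δ) ^ 2 * ‖f‖ ^ 2 ≤ cellSum x N f := by
  have hη : 0 < 1 - ε - δ := by linarith
  -- Here `t` is the ratio of `δ` to the desired lower bound `1 - ε - δ`; a common factor `1 - ε`
  -- then cancels.
  have h1 := integral_le_cellSum_add hmono f (div_pos hδ hη)
  have h3 := stepError_le hδ hmono hgap f
  have h4 : (1 - ε) ^ 2 * ‖f‖ ^ 2 ≤ (1 + δ / (1 - ε - δ)) * cellSum x N f +
      (1 + (δ / (1 - ε - δ))⁻¹) * (δ ^ 2 * ‖f‖ ^ 2) := by
    refine (hf.trans h1).trans ?_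
    gcongr
  have e1 : 1 + δ / (1 - ε - δ) = (1 - ε) / (1 - ε - δ) := by field_simp; ring
  have e2 : (1 + (δ / (1 - ε - δ))⁻¹) * (δ ^ 2 * ‖f‖ ^ 2) = (1 - ε) * (δ * ‖f‖ ^ 2) := by
    field_simp
    ring
  rw [e1, e2] at h4
  have h5 : (1 - ε) * ((1 - ε) * ‖f‖ ^ 2) ≤
      (1 - ε) * (cellSum x N f / (1 - ε - δ) + δ * ‖f‖ ^ 2) := by
    calc _ = (1 - ε) ^ 2 * ‖f‖ ^ 2 := by ring
      _ ≤ _ := h4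
      _ = _ := by ring
  have h6 := le_of_mul_le_mul_left h5 (by linarith)
  have h7 : (1 - ε - δ) * ‖f‖ ^ 2 ≤ cellSum x N f / (1 - ε - δ) := by linarith
  rw [le_div_iff₀ hη] at h7
  calc _ = (1 - ε - δ) * ‖f‖ ^ 2 * (1 - ε - δ) := by ring
    _ ≤ _ := h7

end Cells

/-! ### Fourier modes and energy concentration of trigonometric polynomials. -/

theorem fourierTransform_mode (m : ℤ) (ω : ℝ) :
    fourierTransform (mode m) ω =
      ∫ x in (0 : ℝ)..1, Complex.exp (2 * Real.pi * Complex.I * (m - ω) * x) := by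
  rw [intervalIntegral.integral_of_le zero_le_one, ← restrict_Ioo_eq_restrict_Ioc,
    fourierTransform]
  refine integral_congr_ae ?_
  filter_upwards [(memLp_mode m).coeFn_toLp] with x hx
  rw [mode, hx, ← Complex.exp_add]
  congr 1
  ring

theorem fourierTransform_mode_self (m : ℤ) : fourierTransform (mode m) m = 1 := by
  rw [fourierTransform_mode]
  simp

theorem fourierTransform_mode_of_ne {m : ℤ} {ω : ℝ} (h : (m : ℝ) ≠ ω) :
    fourierTransform (mode m) ω = (Complex.exp (2 * Real.pi * Complex.I * (m - ω)) - 1) /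
      (2 * Real.pi * Complex.I * (m - ω)) := by
  have h0 : (m : ℂ) - ω ≠ 0 := by
    rw [sub_ne_zero]
    exact_mod_cast h
  rw [fourierTransform_mode, integral_exp_mul_complex]
  · simp
  · simp [h0, Real.pi_ne_zero]

theorem norm_fourierTransform_mode_le {m : ℤ} {ω : ℝ} (h : (m : ℝ) ≠ ω) :
    ‖fourierTransform (mode m) ω‖ ≤ 1 / (Real.pi * |m - ω|) := by
  have hsub : (m : ℂ) - ω = ((m - ω : ℝ) : ℂ) := by push_cast; rfl
  have hnum : ‖Complex.exp (2 * Real.pi * Complex.I * (m - ω)) - 1‖ ≤ 2 := by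
    refine (norm_sub_le _ _).trans ?_
    rw [hsub, Complex.norm_exp]
    simp
    norm_num
  have hpos : 0 < |(m : ℝ) - ω| := abs_pos.2 (sub_ne_zero.2 h)
  rw [fourierTransform_mode_of_ne h, norm_div]
  have hden : ‖(2 * Real.pi * Complex.I * (m - ω) : ℂ)‖ = 2 * (Real.pi * |m - ω|) := by
    rw [hsub]
    simp only [norm_mul, Complex.norm_I, Complex.norm_real, Real.norm_eq_abs,
      abs_of_pos Real.pi_pos, Complex.norm_ofNat]
    ring
  rw [hden, div_le_div_iff₀ (by positivity) (by positivity)]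
  have := mul_le_mul_of_nonneg_right hnum (mul_pos Real.pi_pos hpos).le
  linarith

theorem fourierTransform_mode_int {m n : ℤ} (h : n ≠ m) : fourierTransform (mode n) m = 0 := by
  rw [fourierTransform_mode_of_ne (by exact_mod_cast h), Complex.exp_eq_one_iff.2, sub_self,
    zero_div]
  exact ⟨n - m, by push_cast; ring⟩

theorem inner_mode (m : ℤ) (f : H) : inner ℂ (mode m) f = fourierTransform f m := by
  rw [L2.inner_def, fourierTransform]
  refine integral_congr_ae ?_
  filter_upwards [(memLp_mode m).coeFn_toLp] with x hx
  rw [mode, hx, RCLike.inner_apply, ← Complex.exp_conj]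
  congr 2
  simp only [map_mul, Complex.conj_I, Complex.conj_ofReal, map_ofNat, map_intCast,
    Complex.ofReal_intCast]
  ring

theorem orthonormal_mode : Orthonormal ℂ mode := by
  rw [orthonormal_iff_ite]
  intro m n
  rw [inner_mode]
  split_ifs with h
  · rw [h, fourierTransform_mode_self]
  · exact fourierTransform_mode_int fun h' => h h'.symm

theorem norm_sq_sum_mode (s : Finset ℤ) (a : ℤ → ℂ) :
    ‖∑ m ∈ s, a m • mode m‖ ^ 2 = ∑ m ∈ s, ‖a m‖ ^ 2 := by
  have h := orthonormal_mode.inner_sum a a s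
  rw [inner_self_eq_norm_sq_to_K] at h
  simp only [RCLike.conj_mul] at h
  exact_mod_cast h

theorem exists_eq_sum_mode {M : ℕ} {f : H} (hf : f ∈ trigSpace M) :
    ∃ a : ℤ → ℂ, f = ∑ m ∈ Finset.Icc (-(M : ℤ)) M, a m • mode m := by
  rw [trigSpace, ← Finset.coe_Icc, Submodule.mem_span_image_finset_iff_exists_fun'] at hf
  obtain ⟨c, rfl⟩ := hf
  exact ⟨c, rfl⟩

theorem mode_mem_trigSpace (M : ℕ) : mode 0 ∈ trigSpace M :=
  Submodule.subset_span ⟨0, by simp, rfl⟩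

instance finiteDimensional_trigSpace (M : ℕ) : FiniteDimensional ℂ (trigSpace M) :=
  FiniteDimensional.span_of_finite ℂ ((finite_Icc _ _).image _)

/-- For `|ω| ≥ 2M` every frequency `m` is at distance at least `|ω|/2`, so each mode contributes
`O(1/|ω|)`; Cauchy–Schwarz over the `2M + 1` coefficients does the rest. -/
theorem norm_sq_fourierTransform_le_of_mem_trigSpace {M : ℕ} {f : H} (hf : f ∈ trigSpace M)
    {ω : ℝ} (hω : 2 * M ≤ |ω|) (hω0 : 0 < |ω|) :
    ‖fourierTransform f ω‖ ^ 2 ≤ (2 * M + 1) * ‖f‖ ^ 2 / 2 * (|ω| ^ 2)⁻¹ := by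
  obtain ⟨a, rfl⟩ := exists_eq_sum_mode hf
  set s := Finset.Icc (-(M : ℤ)) M
  have hcard : ((s.card : ℕ) : ℝ) = 2 * M + 1 := by
    rw [Int.card_Icc, show ((M : ℤ) + 1 - -(M : ℤ)).toNat = 2 * M + 1 by omega]
    push_cast
    ring
  have hpi := Real.pi_gt_three
  have hmode : ∀ m ∈ s, ‖fourierTransform (mode m) ω‖ ≤ 2 / 3 * |ω|⁻¹ := fun m hm => by
    obtain ⟨h1, h2⟩ := Finset.mem_Icc.1 hm
    have hmM : |(m : ℝ)| ≤ M := by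
      rw [abs_le]
      exact ⟨by exact_mod_cast h1, by exact_mod_cast h2⟩
    have hdist : |ω| / 2 ≤ |(m : ℝ) - ω| := by
      have := abs_sub_abs_le_abs_sub ω m
      rw [abs_sub_comm ω m] at this
      linarith
    have hne : (m : ℝ) ≠ ω := fun h => by
      rw [h, sub_self, abs_zero] at hdist
      linarith
    refine (norm_fourierTransform_mode_le hne).trans ?_
    have : 3 * (|ω| / 2) ≤ Real.pi * |(m : ℝ) - ω| := by gcongr
    calc 1 / (Real.pi * |(m : ℝ) - ω|) ≤ 1 / (3 * (|ω| / 2)) := by gcongr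
      _ = 2 / 3 * |ω|⁻¹ := by field_simp
  have hnorm : ‖fourierTransform (∑ m ∈ s, a m • mode m) ω‖ ≤
      (2 / 3 * |ω|⁻¹) * ∑ m ∈ s, ‖a m‖ := by
    rw [← fourierEval_apply, map_sum, Finset.mul_sum]
    refine (norm_sum_le _ _).trans (Finset.sum_le_sum fun m hm => ?_)
    rw [map_smul, smul_eq_mul, norm_mul, mul_comm]
    exact mul_le_mul_of_nonneg_right (hmode m hm) (norm_nonneg _)
  have hcs : (∑ m ∈ s, ‖a m‖) ^ 2 ≤ (2 * M + 1) * ∑ m ∈ s, ‖a m‖ ^ 2 := by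
    rw [← hcard]
    exact sq_sum_le_card_mul_sum_sq
  calc ‖fourierTransform (∑ m ∈ s, a m • mode m) ω‖ ^ 2
      ≤ ((2 / 3 * |ω|⁻¹) * ∑ m ∈ s, ‖a m‖) ^ 2 := by gcongr
    _ = 4 / 9 * (|ω| ^ 2)⁻¹ * (∑ m ∈ s, ‖a m‖) ^ 2 := by ring
    -- Weakening `4/9` to `1/2` makes the two tails beyond `±R` add up to `(2M+1)‖f‖²/R`.
    _ ≤ 1 / 2 * (|ω| ^ 2)⁻¹ * ((2 * M + 1) * ∑ m ∈ s, ‖a m‖ ^ 2) := by gcongr ?_ * _ * ?_; norm_num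
    _ = _ := by rw [norm_sq_sum_mode]; ring

theorem setIntegral_Ioi_le_of_le_inv_sq {φ : ℝ → ℝ} (hφ : Integrable φ) {C R : ℝ} (hR : 0 < R)
    (h : ∀ ω, R < ω → φ ω ≤ C * (ω ^ 2)⁻¹) : ∫ ω in Ioi R, φ ω ≤ C * R⁻¹ := by
  have hint : IntegrableOn (fun ω : ℝ => C * ω ^ (-2 : ℝ)) (Ioi R) :=
    (integrableOn_Ioi_rpow_of_lt (by norm_num) hR).const_mul C
  have hval : ∫ ω in Ioi R, C * ω ^ (-2 : ℝ) = C * R⁻¹ := by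
    rw [integral_const_mul, integral_Ioi_rpow_of_lt (by norm_num) hR]
    norm_num
    left
    exact Real.rpow_neg_one R
  rw [← hval]
  refine setIntegral_mono_on hφ.integrableOn hint measurableSet_Ioi fun ω hω => ?_
  rw [Real.rpow_neg (hR.trans hω).le, Real.rpow_two]
  exact h ω hω

/-- Trigonometric polynomials have most of their energy in a band larger than their degree. -/
theorem le_integral_band {M : ℕ} {f : H} (hf : f ∈ trigSpace M) {a b R : ℝ} (hR : 0 < R)
    (hMR : 2 * M ≤ R) (ha : a ≤ -R) (hb : R ≤ b) :
    (1 - (2 * M + 1) / R) * ‖f‖ ^ 2 ≤ ∫ ω in a..b, ‖centeredTransform f ω‖ ^ 2 := by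
  set φ : ℝ → ℝ := fun ω => ‖centeredTransform f ω‖ ^ 2 with hφ
  have hint : Integrable φ := integrable_sq_centeredTransform f
  have hnn : ∀ ω, 0 ≤ φ ω := fun ω => by positivity
  have hpt : ∀ ω, R ≤ |ω| → φ ω ≤ (2 * M + 1) * ‖f‖ ^ 2 / 2 * (|ω| ^ 2)⁻¹ := fun ω hω => by
    simp only [hφ, norm_centeredTransform]
    exact norm_sq_fourierTransform_le_of_mem_trigSpace hf (hMR.trans hω) (hR.trans_le hω)
  have hright : ∫ ω in Ioi b, φ ω ≤ (2 * M + 1) * ‖f‖ ^ 2 / 2 * R⁻¹ := by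
    refine (setIntegral_mono_set hint.integrableOn (ae_of_all _ hnn)
      (Ioi_subset_Ioi hb).eventuallyLE).trans (setIntegral_Ioi_le_of_le_inv_sq hint hR
        fun ω hω => ?_)
    rw [← sq_abs ω]
    exact hpt ω (hω.le.trans (le_abs_self _))
  have hleft : ∫ ω in Iic a, φ ω ≤ (2 * M + 1) * ‖f‖ ^ 2 / 2 * R⁻¹ := by
    refine (setIntegral_mono_set hint.integrableOn (ae_of_all _ hnn)
      (Iic_subset_Iic.2 ha).eventuallyLE).trans ?_
    rw [← integral_comp_neg_Ioi]
    refine setIntegral_Ioi_le_of_le_inv_sq hint.comp_neg hR fun ω hω => ?_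
    rw [← sq_abs ω, ← abs_neg ω]
    exact hpt _ (by rw [abs_neg]; exact hω.le.trans (le_abs_self _))
  have hsplit : ∫ ω, φ ω = (∫ ω in Iic a, φ ω) + (∫ ω in a..b, φ ω) + ∫ ω in Ioi b, φ ω := by
    rw [← intervalIntegral.integral_Iic_sub_Iic hint.integrableOn hint.integrableOn,
      add_sub_cancel, intervalIntegral.integral_Iic_add_Ioi hint.integrableOn hint.integrableOn]
  have htot : ∫ ω, φ ω = ‖f‖ ^ 2 := integral_sq_centeredTransform f
  have : (1 - (2 * M + 1) / R) * ‖f‖ ^ 2 =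
      ‖f‖ ^ 2 - 2 * ((2 * M + 1) * ‖f‖ ^ 2 / 2 * R⁻¹) := by
    rw [div_eq_mul_inv]
    ring
  linarith

/-! ### Abstract least squares and quasi-optimality. -/

section LeastSquares

variable {E F : Type*} [NormedAddCommGroup E] [InnerProductSpace ℂ E] [NormedAddCommGroup F]
  [InnerProductSpace ℂ F]

/-- `g` is a least-squares solution in `T` of `A g = A f`. -/
def IsLeastSquares (A : E →ₗ[ℂ] F) (T : Submodule ℂ E) (f g : E) : Prop :=
  g ∈ T ∧ ∀ h ∈ T, ‖A f - A g‖ ≤ ‖A f - A h‖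

/-- The normal equations: `A g` is the point of `A(T)` nearest to `A f` exactly when the residual is
orthogonal to `A(T)`. -/
theorem isLeastSquares_iff {A : E →ₗ[ℂ] F} {T : Submodule ℂ E} {f g : E} :
    IsLeastSquares A T f g ↔ g ∈ T ∧ ∀ h ∈ T, inner ℂ (A f - A g) (A h) = 0 := by
  refine and_congr_right fun hg => ?_
  have key := (T.map A).norm_eq_iInf_iff_inner_eq_zero (u := A f) (Submodule.mem_map_of_mem hg)
  have hbdd : BddBelow (range fun w : T.map A => ‖A f - w‖) :=
    ⟨0, by rintro _ ⟨w, rfl⟩; exact norm_nonneg _⟩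
  constructor
  · intro h k hk
    refine key.1 (le_antisymm (le_ciInf ?_) (ciInf_le hbdd ⟨A g, Submodule.mem_map_of_mem hg⟩)) _
      (Submodule.mem_map_of_mem hk)
    rintro ⟨_, w, hw, rfl⟩
    exact h w hw
  · intro h k hk
    rw [key.2 (by rintro _ ⟨w, hw, rfl⟩; exact h w hw)]
    exact ciInf_le hbdd ⟨A k, Submodule.mem_map_of_mem hk⟩

theorem norm_le_of_inner_sub_eq_zero {y z : F} (h : inner ℂ (y - z) z = 0) : ‖z‖ ≤ ‖y‖ := by
  have h1 := norm_add_sq_eq_norm_sq_add_norm_sq_of_inner_eq_zero (𝕜 := ℂ) (y - z) z h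
  rw [sub_add_cancel] at h1
  nlinarith [norm_nonneg y, norm_nonneg z, mul_self_nonneg ‖y - z‖]

variable {A : E →ₗ[ℂ] F} {T : Submodule ℂ E} {c₁ c₂ : ℝ}

/-- Existence is orthogonal projection onto the finite-dimensional space `A(T)`; uniqueness holds
because the lower bound makes `A` injective on `T`. -/
theorem existsUnique_isLeastSquares [FiniteDimensional ℂ T] (hc₁ : 0 < c₁)
    (hlow : ∀ t ∈ T, c₁ * ‖t‖ ^ 2 ≤ ‖A t‖ ^ 2) (f : E) : ∃! g, IsLeastSquares A T f g := by
  obtain ⟨g, hg, hAg⟩ := ((T.map A).starProjection_apply_mem (A f) :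
    (T.map A).starProjection (A f) ∈ T.map A)
  refine ⟨g, isLeastSquares_iff.2 ⟨hg, fun h hh => ?_⟩, fun k hk => ?_⟩
  · rw [hAg]
    exact (T.map A).starProjection_inner_eq_zero _ _ (Submodule.mem_map_of_mem hh)
  · obtain ⟨hkT, hk⟩ := isLeastSquares_iff.1 hk
    have hmem : k - g ∈ T := T.sub_mem hkT hg
    have h1 := hk _ hmem
    have h2 : inner ℂ (A f - A g) (A (k - g)) = 0 := by
      rw [hAg]
      exact (T.map A).starProjection_inner_eq_zero _ _ (Submodule.mem_map_of_mem hmem)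
    have h3 : inner ℂ (A (k - g)) (A (k - g)) = 0 := by
      have : A (k - g) = (A f - A g) - (A f - A k) := by rw [map_sub]; abel
      nth_rw 1 [this]
      rw [inner_sub_left, h1, h2, sub_zero]
    have h4 := hlow _ hmem
    rw [inner_self_eq_zero.1 h3, norm_zero] at h4
    have h5 : ‖k - g‖ ^ 2 = 0 := by
      have : 0 ≤ ‖k - g‖ ^ 2 := by positivity
      nlinarith
    exact sub_eq_zero.1 (norm_eq_zero.1 (pow_eq_zero_iff two_ne_zero |>.1 h5))

theorem IsLeastSquares.norm_le (hc₁ : 0 < c₁) (hlow : ∀ t ∈ T, c₁ * ‖t‖ ^ 2 ≤ ‖A t‖ ^ 2)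
    (hup : ∀ t, ‖A t‖ ^ 2 ≤ c₂ * ‖t‖ ^ 2) {f g : E} (hg : IsLeastSquares A T f g) :
    ‖g‖ ≤ √(c₂ / c₁) * ‖f‖ := by
  obtain ⟨hgT, horth⟩ := isLeastSquares_iff.1 hg
  have h1 := norm_le_of_inner_sub_eq_zero (horth g hgT)
  have h2 : c₁ * ‖g‖ ^ 2 ≤ c₂ * ‖f‖ ^ 2 :=
    ((hlow g hgT).trans (by gcongr)).trans (hup f)
  have h3 : ‖g‖ ^ 2 ≤ c₂ / c₁ * ‖f‖ ^ 2 := by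
    rw [div_mul_eq_mul_div, le_div_iff₀ hc₁]
    linarith
  calc ‖g‖ = √(‖g‖ ^ 2) := (Real.sqrt_sq (norm_nonneg _)).symm
    _ ≤ √(c₂ / c₁ * ‖f‖ ^ 2) := Real.sqrt_le_sqrt h3
    _ = √(c₂ / c₁) * ‖f‖ := by
      rw [Real.sqrt_mul' _ (by positivity), Real.sqrt_sq (norm_nonneg _)]

/-- Applying `I - P` to `f - h` would give only `1 + √(c₂/c₁)`. Instead split along the orthogonal
projection `p` of `f` onto `T`, with `u = f - p ⊥ T` and `v = g - p ∈ T`, and apply the stability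
bound to the whole family `u + t v`. -/
theorem IsLeastSquares.norm_sub_le [FiniteDimensional ℂ T] (hc₁ : 0 < c₁) (hc : c₁ ≤ c₂)
    (hlow : ∀ t ∈ T, c₁ * ‖t‖ ^ 2 ≤ ‖A t‖ ^ 2) (hup : ∀ t, ‖A t‖ ^ 2 ≤ c₂ * ‖t‖ ^ 2) {f g h : E}
    (hg : IsLeastSquares A T f g) (hh : h ∈ T) : ‖f - g‖ ≤ √(c₂ / c₁) * ‖f - h‖ := by
  obtain ⟨hgT, horth⟩ := isLeastSquares_iff.1 hg
  set p := T.starProjection f with hp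
  have hpT : p ∈ T := T.starProjection_apply_mem f
  have hu : ∀ t ∈ T, inner ℂ (f - p) t = 0 := fun t ht => T.starProjection_inner_eq_zero f t ht
  have hvT : g - p ∈ T := T.sub_mem hgT hpT
  set u := f - p with hudef
  set v := g - p with hvdef
  have hpyth : ∀ t ∈ T, ‖u + t‖ ^ 2 = ‖u‖ ^ 2 + ‖t‖ ^ 2 := fun t ht => by
    have := norm_add_sq_eq_norm_sq_add_norm_sq_of_inner_eq_zero (𝕜 := ℂ) u t (hu t ht)
    simpa only [sq] using this
  have hfg : ‖f - g‖ ^ 2 = ‖u‖ ^ 2 + ‖v‖ ^ 2 := by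
    rw [← norm_neg v, ← hpyth _ (T.neg_mem hvT)]
    congr 2
    rw [hudef, hvdef]
    abel
  have hfh : ‖u‖ ^ 2 ≤ ‖f - h‖ ^ 2 := by
    have := hpyth _ (T.sub_mem hpT hh)
    rw [hudef, sub_add_sub_cancel] at this
    rw [this]
    exact le_add_of_nonneg_right (by positivity)
  have hquad : ∀ t : ℝ, c₁ * ((1 + t) ^ 2 * ‖v‖ ^ 2) ≤ c₂ * (‖u‖ ^ 2 + t ^ 2 * ‖v‖ ^ 2) := by
    intro t
    have hz : ((1 + t : ℝ) : ℂ) • v ∈ T := T.smul_mem _ hvT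
    -- The residual is independent of `t`, so `(1 + t) v` is the reconstruction of `u + t v`.
    have h1 : A (u + (t : ℂ) • v) - A (((1 + t : ℝ) : ℂ) • v) = A f - A g := by
      rw [← map_sub, ← map_sub]
      congr 1
      rw [Complex.ofReal_add, Complex.ofReal_one, add_smul, one_smul, hudef, hvdef]
      abel
    have h2 := norm_le_of_inner_sub_eq_zero (y := A (u + (t : ℂ) • v))
      (z := A (((1 + t : ℝ) : ℂ) • v)) (by rw [h1]; exact horth _ hz)
    have h3 : c₁ * ‖((1 + t : ℝ) : ℂ) • v‖ ^ 2 ≤ c₂ * ‖u + (t : ℂ) • v‖ ^ 2 :=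
      ((hlow _ hz).trans (by gcongr)).trans (hup _)
    rwa [hpyth _ (T.smul_mem _ hvT), norm_smul, norm_smul, mul_pow, mul_pow, Complex.norm_real,
      Complex.norm_real, Real.norm_eq_abs, Real.norm_eq_abs, sq_abs, sq_abs] at h3
  have hmain : c₁ * (‖u‖ ^ 2 + ‖v‖ ^ 2) ≤ c₂ * ‖u‖ ^ 2 := by
    rcases eq_or_ne v 0 with hv | hv
    · rw [hv, norm_zero]
      have := mul_le_mul_of_nonneg_right hc (sq_nonneg ‖u‖)
      linarith
    · have hr : 0 < ‖v‖ ^ 2 := by positivity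
      have hs : 0 ≤ ‖u‖ ^ 2 := by positivity
      -- This `t` maximizes `(1+t)²‖v‖² / (‖u‖² + t²‖v‖²)`, with maximum `(‖u‖² + ‖v‖²)/‖u‖²` when
      -- `u ≠ 0`.
      have h1 := hquad (‖u‖ ^ 2 / ‖v‖ ^ 2)
      clear hquad hpyth hfg hfh
      generalize ‖u‖ ^ 2 = s at *
      generalize ‖v‖ ^ 2 = r at *
      have e1 : c₁ * ((1 + s / r) ^ 2 * r) = c₁ * (s + r) * ((s + r) / r) := by
        field_simp
        ring
      have e2 : c₂ * (s + (s / r) ^ 2 * r) = c₂ * s * ((s + r) / r) := by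
        field_simp
        ring
      rw [e1, e2] at h1
      have hpos : 0 < (s + r) / r := by positivity
      exact le_of_mul_le_mul_right h1 hpos
  have hc₂ : 0 ≤ c₂ := hc₁.le.trans hc
  have h3 : ‖f - g‖ ^ 2 ≤ c₂ / c₁ * ‖f - h‖ ^ 2 := by
    rw [div_mul_eq_mul_div, le_div_iff₀ hc₁, hfg]
    have := mul_le_mul_of_nonneg_left hfh hc₂
    linarith
  calc ‖f - g‖ = √(‖f - g‖ ^ 2) := (Real.sqrt_sq (norm_nonneg _)).symm
    _ ≤ √(c₂ / c₁ * ‖f - h‖ ^ 2) := Real.sqrt_le_sqrt h3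
    _ = √(c₂ / c₁) * ‖f - h‖ := by
      rw [Real.sqrt_mul' _ (by positivity), Real.sqrt_sq (norm_nonneg _)]

end LeastSquares

/-! ### Weak derivatives of trigonometric polynomials. -/

theorem integrable_mul_compactSupport (f : H) {ψ : ℝ → ℝ} (hψ : Continuous ψ)
    (hs : HasCompactSupport ψ) :
    Integrable (fun x => f x * (ψ x : ℂ)) (volume.restrict (Ioo (0 : ℝ) 1)) := by
  obtain ⟨C, hC⟩ := hs.exists_bound_of_continuous hψ
  refine (integrable_coe f).mul_bdd (c := C) ?_ (ae_of_all _ fun x => ?_)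
  · exact (Complex.continuous_ofReal.comp hψ).aestronglyMeasurable
  · rw [Complex.norm_real]
    exact hC x

theorem IsWeakDeriv.add {f₁ f₂ g₁ g₂ : H} (h₁ : IsWeakDeriv f₁ g₁) (h₂ : IsWeakDeriv f₂ g₂) :
    IsWeakDeriv (f₁ + f₂) (g₁ + g₂) := by
  intro φ hφ hs ht
  have hcd : Continuous (deriv φ) := hφ.continuous_deriv (by simp)
  have e₁ : ∫ x in Ioo (0 : ℝ) 1, (f₁ + f₂ : H) x * ((deriv φ x : ℝ) : ℂ) =
      (∫ x in Ioo (0 : ℝ) 1, f₁ x * ((deriv φ x : ℝ) : ℂ)) +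
        ∫ x in Ioo (0 : ℝ) 1, f₂ x * ((deriv φ x : ℝ) : ℂ) := by
    rw [← integral_add (integrable_mul_compactSupport f₁ hcd hs.deriv)
      (integrable_mul_compactSupport f₂ hcd hs.deriv)]
    refine integral_congr_ae ?_
    filter_upwards [Lp.coeFn_add f₁ f₂] with x hx
    rw [hx, Pi.add_apply, add_mul]
  have e₂ : ∫ x in Ioo (0 : ℝ) 1, (g₁ + g₂ : H) x * (φ x : ℂ) =
      (∫ x in Ioo (0 : ℝ) 1, g₁ x * (φ x : ℂ)) + ∫ x in Ioo (0 : ℝ) 1, g₂ x * (φ x : ℂ) := by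
    rw [← integral_add (integrable_mul_compactSupport g₁ hφ.continuous hs)
      (integrable_mul_compactSupport g₂ hφ.continuous hs)]
    refine integral_congr_ae ?_
    filter_upwards [Lp.coeFn_add g₁ g₂] with x hx
    rw [hx, Pi.add_apply, add_mul]
  rw [e₁, e₂, h₁ φ hφ hs ht, h₂ φ hφ hs ht, neg_add]

theorem IsWeakDeriv.smul {f g : H} (a : ℂ) (h : IsWeakDeriv f g) :
    IsWeakDeriv (a • f) (a • g) := by
  intro φ hφ hs ht
  have e : ∀ (k : H) (ψ : ℝ → ℝ), ∫ x in Ioo (0 : ℝ) 1, (a • k : H) x * (ψ x : ℂ) =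
      a * ∫ x in Ioo (0 : ℝ) 1, k x * (ψ x : ℂ) := fun k ψ => by
    rw [← integral_const_mul]
    refine integral_congr_ae ?_
    filter_upwards [Lp.coeFn_smul a k] with x hx
    rw [hx, Pi.smul_apply, smul_eq_mul, mul_assoc]
  rw [e f (deriv φ), e g φ, h φ hφ hs ht, mul_neg]

theorem isWeakDeriv_mode (m : ℤ) :
    IsWeakDeriv (mode m) ((2 * Real.pi * Complex.I * m : ℂ) • mode m) := by
  intro φ hφ hs ht
  have hcd : Continuous (deriv φ) := hφ.continuous_deriv (by simp)
  have hc := hφ.continuous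
  -- Test functions vanish at both endpoints, so integration by parts leaves no boundary term.
  have hend : ∀ x, x ∉ Ioo (0 : ℝ) 1 → (φ x : ℂ) = 0 := fun x hx => by
    rw [image_eq_zero_of_notMem_tsupport fun h => hx (ht h), Complex.ofReal_zero]
  set e : ℝ → ℂ := fun x => Complex.exp (2 * Real.pi * Complex.I * m * x) with he
  have hed : ∀ x : ℝ, HasDerivAt e (2 * Real.pi * Complex.I * m * e x) x := fun x => by
    have h := ((hasDerivAt_id (x : ℂ)).const_mul
      (2 * Real.pi * Complex.I * m : ℂ)).cexp.comp_ofReal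
    refine h.congr_deriv ?_
    rw [id, mul_one, mul_comm]
  have hφd : ∀ x : ℝ, HasDerivAt (fun x => (φ x : ℂ)) ((deriv φ x : ℝ) : ℂ) x := fun x =>
    ((hφ.differentiable (by simp)).differentiableAt.hasDerivAt).ofReal_comp
  have hec : Continuous e := by fun_prop
  have hparts := intervalIntegral.integral_mul_deriv_eq_deriv_mul (a := 0) (b := 1)
    (fun x _ => hed x) (fun x _ => hφd x)
    ((hec.const_mul _).intervalIntegrable _ _)
    ((Complex.continuous_ofReal.comp hcd).intervalIntegrable _ _)
  rw [hend 0 (by simp), hend 1 (by simp), mul_zero, mul_zero, sub_zero, zero_sub,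
    intervalIntegral.integral_of_le zero_le_one, intervalIntegral.integral_of_le zero_le_one,
    ← restrict_Ioo_eq_restrict_Ioc] at hparts
  have e₁ : ∫ x in Ioo (0 : ℝ) 1, mode m x * ((deriv φ x : ℝ) : ℂ) =
      ∫ x in Ioo (0 : ℝ) 1, e x * ((deriv φ x : ℝ) : ℂ) := by
    refine integral_congr_ae ?_
    filter_upwards [(memLp_mode m).coeFn_toLp] with x hx
    rw [mode, hx]
  have e₂ : ∫ x in Ioo (0 : ℝ) 1, ((2 * Real.pi * Complex.I * m : ℂ) • mode m : H) x * (φ x : ℂ) =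
      ∫ x in Ioo (0 : ℝ) 1, 2 * Real.pi * Complex.I * m * e x * (φ x : ℂ) := by
    refine integral_congr_ae ?_
    filter_upwards [(memLp_mode m).coeFn_toLp,
      Lp.coeFn_smul (2 * Real.pi * Complex.I * m : ℂ) (mode m)] with x hx hx'
    rw [hx', Pi.smul_apply, smul_eq_mul, mode, hx]
  rw [e₁, e₂, hparts]

theorem isWeakDeriv_sum {ι : Type*} (s : Finset ι) {f g : ι → H}
    (h : ∀ i ∈ s, IsWeakDeriv (f i) (g i)) : IsWeakDeriv (∑ i ∈ s, f i) (∑ i ∈ s, g i) := by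
  classical
  induction s using Finset.induction_on with
  | empty => simpa using (isWeakDeriv_mode 0).smul 0
  | insert i s hi ih =>
    rw [Finset.sum_insert hi, Finset.sum_insert hi]
    exact (h i (Finset.mem_insert_self i s)).add
      (ih fun j hj => h j (Finset.mem_insert_of_mem hj))

/-- Both candidates pair equally with every test function on `(0,1)`, so their difference vanishes
almost everywhere by the fundamental lemma of the calculus of variations. -/
theorem IsWeakDeriv.unique {f g g' : H} (h : IsWeakDeriv f g) (h' : IsWeakDeriv f g') :
    g = g' := by
  have hd : ∀ᵐ x ∂(volume : Measure ℝ), x ∈ Ioo (0 : ℝ) 1 → g x - g' x = 0 := by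
    refine isOpen_Ioo.ae_eq_zero_of_integral_contDiff_smul_eq_zero
      (IntegrableOn.locallyIntegrableOn ((integrable_coe g).sub (integrable_coe g')))
      fun φ hφ hs ht => ?_
    have hsupp : ∀ x, x ∉ Ioo (0 : ℝ) 1 → φ x • (g x - g' x) = 0 := fun x hx => by
      rw [image_eq_zero_of_notMem_tsupport fun h => hx (ht h), zero_smul]
    rw [← setIntegral_eq_integral_of_forall_compl_eq_zero hsupp]
    have e := (h φ hφ hs ht).symm.trans (h' φ hφ hs ht)
    have e' : ∫ x in Ioo (0 : ℝ) 1, φ x • (g x - g' x) =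
        (∫ x in Ioo (0 : ℝ) 1, g x * (φ x : ℂ)) - ∫ x in Ioo (0 : ℝ) 1, g' x * (φ x : ℂ) := by
      rw [← integral_sub (integrable_mul_compactSupport g hφ.continuous hs)
        (integrable_mul_compactSupport g' hφ.continuous hs)]
      refine integral_congr_ae (ae_of_all _ fun x => ?_)
      simp only [Complex.real_smul]
      ring
    rw [e', neg_injective e, sub_self]
  refine Lp.ext ?_
  filter_upwards [(ae_restrict_iff' measurableSet_Ioo).2 hd] with x hx
  exact sub_eq_zero.1 hx

/-- Bernstein's inequality in `L²` for trigonometric polynomials. -/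
theorem exists_isWeakDeriv_of_mem_trigSpace {M : ℕ} {f : H} (hf : f ∈ trigSpace M) :
    ∃ g, IsWeakDeriv f g ∧ ‖g‖ ≤ 2 * Real.pi * M * ‖f‖ := by
  obtain ⟨a, rfl⟩ := exists_eq_sum_mode hf
  refine ⟨∑ m ∈ Finset.Icc (-(M : ℤ)) M, a m • (2 * Real.pi * Complex.I * m : ℂ) • mode m,
    isWeakDeriv_sum _ fun m _ => (isWeakDeriv_mode m).smul (a m), ?_⟩
  refine le_of_sq_le_sq ?_ (by positivity)
  simp_rw [smul_smul]
  rw [mul_pow, norm_sq_sum_mode, norm_sq_sum_mode, Finset.mul_sum]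
  refine Finset.sum_le_sum fun m hm => ?_
  obtain ⟨h1, h2⟩ := Finset.mem_Icc.1 hm
  have hmM : |(m : ℝ)| ≤ M := by
    rw [abs_le]
    exact ⟨by exact_mod_cast h1, by exact_mod_cast h2⟩
  have hn : ‖(2 * Real.pi * Complex.I * m : ℂ)‖ = 2 * Real.pi * |(m : ℝ)| := by
    simp [abs_of_pos Real.pi_pos]
  rw [norm_mul, hn, mul_pow, mul_comm]
  gcongr

theorem gammaConst_trigSpace_le (M : ℕ) :
    gammaConst (trigSpace M) ≤ ENNReal.ofReal (2 * Real.pi * M) := by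
  refine iSup_le fun f => iSup_le fun g => iSup_le fun ⟨hf, hn, hw⟩ => ?_
  obtain ⟨g', hg', hle⟩ := exists_isWeakDeriv_of_mem_trigSpace hf
  rw [hw.unique hg', ← ofReal_norm]
  rw [hn, mul_one] at hle
  exact ENNReal.ofReal_le_ofReal hle

/-! ### Sampling sets, optimal constants and the sampling operator. -/

section Sampling

variable {δ : ℝ} {ω : ℕ → ℕ → ℝ} {K : ℕ → ℝ} {N : ℕ}

theorem extPoint_of_mem {n : ℕ} (hn : n ∈ Icc 1 N) : extPoint ω K N n = ω N n := by
  obtain ⟨h1, h2⟩ := hn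
  rw [extPoint, if_neg (by omega), if_neg (by omega)]

theorem extPoint_zero : extPoint ω K N 0 = ω N N - 2 * K N := if_pos rfl

theorem extPoint_last : extPoint ω K N (N + 1) = ω N 1 + 2 * K N := by
  rw [extPoint, if_neg (by omega), if_pos rfl]

/-- The two wraparound gaps are nonnegative because all points lie in an interval of length `2K`. -/
theorem UniformlyDense.extPoint_le_succ (h : UniformlyDense δ ω K) (hN : 1 ≤ N) :
    ∀ n ≤ N, extPoint ω K N n ≤ extPoint ω K N (n + 1) := by
  intro n hn
  have h1 := h.mem_band N hN 1 ⟨le_rfl, hN⟩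
  have h2 := h.mem_band N hN N ⟨hN, le_rfl⟩
  rcases Nat.eq_zero_or_pos n with rfl | hn0
  · rw [extPoint_zero, zero_add, extPoint_of_mem ⟨le_rfl, hN⟩]
    linarith [h1.1, h2.2]
  · rcases hn.eq_or_lt with rfl | hlt
    · rw [extPoint_last, extPoint_of_mem ⟨hN, le_rfl⟩]
      linarith [h1.1, h2.2]
    · rw [extPoint_of_mem ⟨hn0, hn⟩, extPoint_of_mem ⟨by omega, hlt⟩]
      exact (h.ordered N hN ⟨hn0, hn⟩ ⟨by omega, hlt⟩ n.lt_succ_self).le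

theorem weight_succ (n : ℕ) : weight ω K N (n + 1) =
    midpt (extPoint ω K N) (n + 1) - midpt (extPoint ω K N) n := by
  rw [weight, midpt, midpt, Nat.add_sub_cancel]
  ring

theorem UniformlyDense.weight_nonneg (h : UniformlyDense δ ω K) {n : ℕ} (hn : n ∈ Icc 1 N) :
    0 ≤ weight ω K N n := by
  obtain ⟨h1, h2⟩ := hn
  obtain ⟨k, rfl⟩ := Nat.exists_eq_add_of_le' h1
  rw [weight_succ, sub_nonneg]
  exact midpt_le_succ (h.extPoint_le_succ (h1.trans h2)) h2

theorem sampleSum_eq_cellSum (f : H) : sampleSum ω K N f = cellSum (extPoint ω K N) N f := by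
  have hIcc : Finset.Icc 1 N = Finset.Ico (0 + 1) (N + 1) := by
    ext n
    simp only [Finset.mem_Icc, Finset.mem_Ico]
    omega
  rw [sampleSum, cellSum, Finset.range_eq_Ico, hIcc, ← Finset.sum_Ico_add']
  refine Finset.sum_congr rfl fun n hn => ?_
  have := (Finset.mem_Ico.1 hn).2
  rw [weight_succ, extPoint_of_mem ⟨by omega, by omega⟩]

theorem UniformlyDense.sampleSum_le (h : UniformlyDense δ ω K) (hN : 1 ≤ N) (f : H) :
    sampleSum ω K N f ≤ (1 + δ) ^ 2 * ‖f‖ ^ 2 := by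
  rw [sampleSum_eq_cellSum]
  exact cellSum_le h.delta_pos (h.extPoint_le_succ hN) (h.gap_le N hN) f

theorem UniformlyDense.le_sampleSum (h : UniformlyDense δ ω K) (hN : 1 ≤ N) {ε : ℝ} (hε0 : 0 < ε)
    (hε1 : ε < 1) (hεδ : ε < 1 - δ) {M : ℕ} (hM : max (M : ℝ) 1 ≤ ε / 10 * K N) {f : H}
    (hf : f ∈ trigSpace M) : (1 - ε - δ) ^ 2 * ‖f‖ ^ 2 ≤ sampleSum ω K N f := by
  have hM1 : (M : ℝ) ≤ ε / 10 * K N := (le_max_left _ _).trans hM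
  have hM2 : 1 ≤ ε / 10 * K N := (le_max_right _ _).trans hM
  have hK0 := h.bandwidth_nonneg N hN
  have hεK : ε * K N ≤ K N := mul_le_of_le_one_left hK0 hε1.le
  have hK : 10 ≤ K N := by linarith
  have hδ1 := h.delta_lt_one
  have h1 := h.mem_band N hN 1 ⟨le_rfl, hN⟩
  have h2 := h.mem_band N hN N ⟨hN, le_rfl⟩
  have hg := h.gap_le N hN 0 (Nat.zero_le _)
  rw [zero_add, extPoint_zero, extPoint_of_mem ⟨le_rfl, hN⟩] at hg
  rw [sampleSum_eq_cellSum]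
  refine le_cellSum h.delta_pos hεδ (h.extPoint_le_succ hN) (h.gap_le N hN) f ?_
  -- The wraparound gap is at most `δ < 1`, so the outer midpoints lie beyond `∓(K - 1/2)`, and with
  -- `K ≥ 10` they leave room for `[-K/2, K/2]`.
  have hband := le_integral_band (a := midpt (extPoint ω K N) 0) (b := midpt (extPoint ω K N) N)
    (R := K N / 2) hf (by linarith) (by linarith)
    (by rw [midpt, extPoint_zero, zero_add, extPoint_of_mem ⟨le_rfl, hN⟩]; linarith [h2.2])
    (by rw [midpt, extPoint_last, extPoint_of_mem ⟨hN, le_rfl⟩]; linarith [h1.1])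
  refine le_trans ?_ hband
  -- `2M + 1 ≤ 3 max(M,1) ≤ 3εK/10`, which is below `εK/2`. The resulting `1 - ε` dominates `(1 -
  -- ε)²`.
  have hfrac : (2 * (M : ℝ) + 1) / (K N / 2) ≤ ε := by
    rw [div_le_iff₀ (by linarith)]
    nlinarith
  gcongr
  nlinarith

theorem norm_mode (m : ℤ) : ‖mode m‖ = 1 := orthonormal_mode.1 m

/-- The constant mode has norm one and lies in every `trigSpace M`, so it bounds every admissible
constant. Real `sSup` and `sInf` default to `0` on empty or unbounded sets, hence the need for such
bounds. -/
theorem bddAbove_lowerConst {M : ℕ} : sampleSum ω K N (mode 0) ∈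
    upperBounds {c : ℝ | ∀ f ∈ trigSpace M, c * ‖f‖ ^ 2 ≤ sampleSum ω K N f} := fun c hc => by
  simpa [norm_mode] using hc _ (mode_mem_trigSpace M)

theorem bddBelow_upperConst : sampleSum ω K N (mode 0) ∈
    lowerBounds {c : ℝ | ∀ f : H, sampleSum ω K N f ≤ c * ‖f‖ ^ 2} := fun c hc => by
  simpa [norm_mode] using hc (mode 0)

theorem le_lowerConst {M : ℕ} {c : ℝ}
    (hc : ∀ f ∈ trigSpace M, c * ‖f‖ ^ 2 ≤ sampleSum ω K N f) :
    c ≤ lowerConst ω K N (trigSpace M) :=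
  le_csSup ⟨_, bddAbove_lowerConst⟩ hc

/-- The supremum is itself admissible: for `f ≠ 0` the quotient of the sampling sum by `‖f‖²` bounds
every admissible constant. The given `c` ensures that the set is nonempty. -/
theorem lowerConst_mul_le {M : ℕ} {c : ℝ}
    (hc : ∀ f ∈ trigSpace M, c * ‖f‖ ^ 2 ≤ sampleSum ω K N f) {f : H} (hf : f ∈ trigSpace M) :
    lowerConst ω K N (trigSpace M) * ‖f‖ ^ 2 ≤ sampleSum ω K N f := by
  rcases eq_or_ne f 0 with rfl | hf0
  · simpa using hc 0 hf
  · rw [← le_div_iff₀ (by positivity)]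
    refine csSup_le ⟨c, hc⟩ fun d hd => ?_
    rw [le_div_iff₀ (by positivity)]
    exact hd f hf

theorem upperConst_le {c : ℝ} (hc : ∀ f : H, sampleSum ω K N f ≤ c * ‖f‖ ^ 2) :
    upperConst ω K N ≤ c :=
  csInf_le ⟨_, bddBelow_upperConst⟩ hc

theorem sampleSum_le_upperConst {c : ℝ} (hc : ∀ f : H, sampleSum ω K N f ≤ c * ‖f‖ ^ 2) (f : H) :
    sampleSum ω K N f ≤ upperConst ω K N * ‖f‖ ^ 2 := by
  rcases eq_or_ne f 0 with rfl | hf0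
  · simpa using hc 0
  · rw [← div_le_iff₀ (by positivity)]
    refine le_csInf ⟨c, hc⟩ fun d hd => ?_
    rw [div_le_iff₀ (by positivity)]
    exact hd f

theorem lowerConst_le_upperConst {M : ℕ} {c d : ℝ}
    (hc : ∀ f ∈ trigSpace M, c * ‖f‖ ^ 2 ≤ sampleSum ω K N f)
    (hd : ∀ f : H, sampleSum ω K N f ≤ d * ‖f‖ ^ 2) :
    lowerConst ω K N (trigSpace M) ≤ upperConst ω K N := by
  have h₁ : lowerConst ω K N (trigSpace M) ≤ sampleSum ω K N (mode 0) :=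
    csSup_le ⟨c, hc⟩ bddAbove_lowerConst
  exact h₁.trans (le_csInf ⟨d, hd⟩ bddBelow_upperConst)

/-- The weighted sampling operator. -/
noncomputable def sampleOp (ω : ℕ → ℕ → ℝ) (K : ℕ → ℝ) (N : ℕ) :
    H →ₗ[ℂ] EuclideanSpace ℂ (Finset.Icc 1 N) :=
  (WithLp.linearEquiv 2 ℂ (Finset.Icc 1 N → ℂ)).symm.toLinearMap ∘ₗ
    LinearMap.pi fun n => ((√(weight ω K N n) : ℝ) : ℂ) • fourierEval (ω N n)

theorem UniformlyDense.norm_sq_sampleOp (h : UniformlyDense δ ω K) (f : H) :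
    ‖sampleOp ω K N f‖ ^ 2 = sampleSum ω K N f := by
  rw [EuclideanSpace.norm_sq_eq, sampleSum, ← Finset.sum_coe_sort (Finset.Icc 1 N)]
  refine Finset.sum_congr rfl fun n _ => ?_
  have hw : 0 ≤ weight ω K N n := h.weight_nonneg (Finset.mem_Icc.1 n.2)
  change ‖((√(weight ω K N n) : ℝ) : ℂ) * fourierTransform f (ω N n)‖ ^ 2 = _
  rw [norm_mul, mul_pow, Complex.norm_real, Real.norm_eq_abs, sq_abs, Real.sq_sqrt hw]

/-- Nonnegative weights let their square roots be absorbed into the operator, so the functional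
becomes a squared Euclidean distance. -/
theorem UniformlyDense.isReconstruction_iff (h : UniformlyDense δ ω K) (T : Submodule ℂ H)
    (f g : H) : IsReconstruction ω K N T f g ↔ IsLeastSquares (sampleOp ω K N) T f g := by
  have e : ∀ k : H, ∑ n ∈ Finset.Icc 1 N, weight ω K N n *
      ‖fourierTransform f (ω N n) - fourierTransform k (ω N n)‖ ^ 2 =
        ‖sampleOp ω K N f - sampleOp ω K N k‖ ^ 2 := fun k => by
    rw [← map_sub, h.norm_sq_sampleOp, sampleSum]
    simp only [← fourierEval_apply, map_sub]
  rw [IsReconstruction, IsLeastSquares, and_comm, isMinOn_iff]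
  simp only [e, sq_le_sq₀ (norm_nonneg _) (norm_nonneg _), SetLike.mem_coe]

end Sampling

end NUGS

/-! ### Assembly of the theorem. -/

theorem mainTheorem5 :
    (∀ M : ℕ, (∀ f ∈ NUGS.trigSpace M, NUGS.MemH1 f) ∧
      NUGS.gammaConst (NUGS.trigSpace M) ≤ ENNReal.ofReal (2 * Real.pi * M)) ∧
    (∀ ε : ℝ, 0 < ε → ε < 1 → ∃ c : ℝ, 0 < c ∧
      ∀ (δ : ℝ) (ω : ℕ → ℕ → ℝ) (K : ℕ → ℝ), NUGS.UniformlyDense δ ω K → ε < 1 - δ →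
      ∀ N M : ℕ, 1 ≤ N → max (M : ℝ) 1 ≤ c * K N →
        0 < NUGS.lowerConst ω K N (NUGS.trigSpace M) ∧
        NUGS.reconstructionConst ω K N (NUGS.trigSpace M) ≤ (1 + δ) / (1 - ε - δ) ∧
        ∀ f : NUGS.H,
          (∃! g : NUGS.H, NUGS.IsReconstruction ω K N (NUGS.trigSpace M) f g) ∧
          ∀ g : NUGS.H, NUGS.IsReconstruction ω K N (NUGS.trigSpace M) f g →
            ‖f - g‖ ≤ NUGS.reconstructionConst ω K N (NUGS.trigSpace M) *
              (⨅ h : NUGS.trigSpace M, ‖f - (h : NUGS.H)‖) ∧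
            ‖g‖ ≤ NUGS.reconstructionConst ω K N (NUGS.trigSpace M) * ‖f‖) := by
  refine ⟨fun M => ⟨fun f hf => ?_, NUGS.gammaConst_trigSpace_le M⟩, fun ε hε0 hε1 =>
    ⟨ε / 10, by positivity, fun δ ω K h hεδ N M hN hM => ?_⟩⟩
  · obtain ⟨g, hg, -⟩ := NUGS.exists_isWeakDeriv_of_mem_trigSpace hf
    exact ⟨g, hg⟩
  have hη : 0 < 1 - ε - δ := by linarith
  have hδ := h.delta_pos
  have hlow : ∀ f ∈ NUGS.trigSpace M, (1 - ε - δ) ^ 2 * ‖f‖ ^ 2 ≤ NUGS.sampleSum ω K N f :=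
    fun f hf => h.le_sampleSum hN hε0 hε1 hεδ hM hf
  have hup : ∀ f : NUGS.H, NUGS.sampleSum ω K N f ≤ (1 + δ) ^ 2 * ‖f‖ ^ 2 :=
    h.sampleSum_le hN
  have hC₁ : (1 - ε - δ) ^ 2 ≤ NUGS.lowerConst ω K N (NUGS.trigSpace M) :=
    NUGS.le_lowerConst hlow
  have hC₂ : NUGS.upperConst ω K N ≤ (1 + δ) ^ 2 := NUGS.upperConst_le hup
  have hpos : 0 < NUGS.lowerConst ω K N (NUGS.trigSpace M) := (by positivity : (0 : ℝ) <
    (1 - ε - δ) ^ 2).trans_le hC₁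
  have hlow' : ∀ f ∈ NUGS.trigSpace M,
      NUGS.lowerConst ω K N (NUGS.trigSpace M) * ‖f‖ ^ 2 ≤ ‖NUGS.sampleOp ω K N f‖ ^ 2 :=
    fun f hf => by
      rw [h.norm_sq_sampleOp]
      exact NUGS.lowerConst_mul_le hlow hf
  have hup' : ∀ f : NUGS.H,
      ‖NUGS.sampleOp ω K N f‖ ^ 2 ≤ NUGS.upperConst ω K N * ‖f‖ ^ 2 := fun f => by
    rw [h.norm_sq_sampleOp]
    exact NUGS.sampleSum_le_upperConst hup f
  refine ⟨hpos, ?_, fun f => ⟨?_, fun g hg => ?_⟩⟩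
  · rw [NUGS.reconstructionConst]
    refine Real.sqrt_le_iff.2 ⟨by positivity, ?_⟩
    rw [div_pow]
    gcongr
  · simp only [h.isReconstruction_iff]
    exact NUGS.existsUnique_isLeastSquares hpos hlow' f
  · rw [h.isReconstruction_iff] at hg
    refine ⟨?_, hg.norm_le hpos hlow' hup'⟩
    -- With the constant moved inside the infimum, it suffices to compare with each single element
    -- of `trigSpace M`.
    rw [NUGS.reconstructionConst, Real.mul_iInf_of_nonneg (Real.sqrt_nonneg _)]
    exact le_ciInf fun k => hg.norm_sub_le hpos (NUGS.lowerConst_le_upperConst hlow hup)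
      hlow' hup' k.2
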